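/- For a finite nonempty set $M$ of points of a metric space $(X,\rho)$, let $\operatorname{mst}(M)$ be the length of a minimal spanning tree for $M$, i.e. the least value of $\sum_{\{p,q\}\in E}\rho(p,q)$ over all connected simple graphs $(M,E)$ with vertex set $M$. Let $\operatorname{smt}(M)=\inf_N\operatorname{mst}(N)$, where $N$ runs over all finite sets with $M\subseteq N\subseteq X$ (the length of a shortest, or Steiner minimal, tree connecting $M$). The Steiner ratio of $(X,\rho)$ is $$\operatorname{sr}(X,\rho)=\inf_{M}\frac{\operatorname{smt}(M)}{\operatorname{mst}(M)},$$ where the infimum is over all finite sets $M\subseteq X$ with $|M|\ge 2$. Let $\rho_2$ be the Euclidean metric on $\mathbb{R}^n$. Then for every integer $n\ge 3$, $$\operatorname{sr}(\mathbb{R}^n,\rho_2)<\sqrt{\frac12+\frac1{2n}}.$$ -/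

import Mathlib

noncomputable section

namespace SteinerTree

variable {X : Type*} [MetricSpace X]

/-- The weight of an edge of the complete graph on a finite set `M` of points of a metric space:
the distance between its two endpoints. -/
def edgeLength {M : Finset X} (e : Sym2 M) : ℝ :=
  Sym2.lift ⟨fun p q : M => dist (p : X) (q : X), fun p q => dist_comm (p : X) (q : X)⟩ e

open Classical in
/-- The length of a graph with vertex set `M` (a spanning subgraph of the complete graph on `M`):
the sum of the lengths of its edges. -/
def graphLength {M : Finset X} (G : SimpleGraph M) : ℝ :=
  ∑ e ∈ G.edgeFinset, edgeLength e

/-- The length of a minimal spanning tree for `M`: the least length of a connected graph with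
vertex set `M`. For nonempty `M` the index set is finite and nonempty. -/
def mst (M : Finset X) : ℝ :=
  ⨅ G : {G : SimpleGraph M // G.Connected}, graphLength G.1

/-- The length of a shortest (Steiner minimal) tree connecting `M`: the infimum of `mst N` over
all finite sets `N` of points of the space that contain `M`. -/
def smt (M : Finset X) : ℝ :=
  ⨅ N : {N : Finset X // M ⊆ N}, mst N.1

/-- The Steiner ratio of a finite set `M` (meant for sets of at least two points). -/
def setSteinerRatio (M : Finset X) : ℝ :=
  smt M / mst M

variable (X) in
/-- The Steiner ratio of a metric space: the infimum of the Steiner ratios of its finite subsets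
that have at least two points. -/
def steinerRatio : ℝ :=
  ⨅ M : {M : Finset X // 2 ≤ M.card}, setSteinerRatio M.1

end SteinerTree

end

/-!
The witness is the vertex set `M` of a regular simplex in `ℝⁿ`, with `n + 1` vertices at mutual
distance `√2`. A connected graph on `n + 1` vertices has at least `n` edges, so `mst M ≥ n √2`
(`mul_le_mst`). Joining all vertices to the centre gives a tree of length `(n + 1) R`, where
`R = √(n / (n + 1))` is the circumradius; this alone gives the ratio
`(n + 1) R / (n √2) = √(1 / 2 + 1 / (2 n))`.

The inequality is strict because two edges of this star meet at the centre at an angle with cosine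
`-1 / n ≥ -1 / 3`, hence at less than `120°`. Such a fork becomes shorter when its branching
point is moved a little into the angle (`norm_add_norm_sub_add_norm_sub_lt`). So the
tree which uses the centre and one further point is strictly shorter than the star.

Trees are never built explicitly: `mst_insert_le` says that one more point costs at most its
distance to a point that is already there, and iterating it (`mst_union_image_le`) bounds `mst` of
the set of vertices and additional points.
-/

namespace SteinerTree

/-! ### Minimal spanning trees -/

lemma nonempty_connected {X : Type*} {M : Finset X} (hM : M.Nonempty) :
    Nonempty {G : SimpleGraph M // G.Connected} :=
  have : Nonempty M := hM.to_subtype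
  ⟨⟨⊤, SimpleGraph.connected_top⟩⟩

section MetricSpace

variable {X : Type*} [MetricSpace X]

lemma edgeLength_nonneg {M : Finset X} (e : Sym2 M) : 0 ≤ edgeLength e := by
  induction e using Sym2.ind with
  | _ p q => exact dist_nonneg

lemma graphLength_eq_sum {M : Finset X} (G : SimpleGraph M) [Fintype G.edgeSet] :
    graphLength G = ∑ e ∈ G.edgeFinset, edgeLength e := by
  unfold graphLength
  congr!

lemma graphLength_nonneg {M : Finset X} (G : SimpleGraph M) : 0 ≤ graphLength G :=
  Finset.sum_nonneg fun e _ => edgeLength_nonneg e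

lemma bddBelow_range_graphLength (M : Finset X) :
    BddBelow (Set.range fun G : {G : SimpleGraph M // G.Connected} => graphLength G.1) :=
  ⟨0, by rintro _ ⟨G, rfl⟩; exact graphLength_nonneg G.1⟩

lemma mst_le_graphLength {M : Finset X} {G : SimpleGraph M} (hG : G.Connected) :
    mst M ≤ graphLength G :=
  ciInf_le (bddBelow_range_graphLength M) ⟨G, hG⟩

lemma mst_nonneg (M : Finset X) : 0 ≤ mst M :=
  Real.iInf_nonneg fun G => graphLength_nonneg G.1

lemma smt_nonneg (M : Finset X) : 0 ≤ smt M :=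
  Real.iInf_nonneg fun N => mst_nonneg N.1

lemma smt_le_mst {M N : Finset X} (h : M ⊆ N) : smt M ≤ mst N :=
  ciInf_le (f := fun N : {N : Finset X // M ⊆ N} => mst N.1)
    ⟨0, by rintro _ ⟨N, rfl⟩; exact mst_nonneg N.1⟩ ⟨N, h⟩

lemma steinerRatio_le {M : Finset X} (hM : 2 ≤ M.card) : steinerRatio X ≤ smt M / mst M :=
  ciInf_le (f := fun M : {M : Finset X // 2 ≤ M.card} => setSteinerRatio M.1)
    ⟨0, by rintro _ ⟨M, rfl⟩; exact div_nonneg (smt_nonneg M.1) (mst_nonneg M.1)⟩ ⟨M, hM⟩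

lemma mst_singleton (x : X) : mst {x} = 0 := by
  classical
  obtain ⟨G, hG⟩ := nonempty_connected (Finset.singleton_nonempty x)
  refine le_antisymm ((mst_le_graphLength hG).trans ?_) (mst_nonneg _)
  refine Finset.sum_nonpos fun e _ => ?_
  induction e using Sym2.ind with
  | _ p q =>
    have hp := Finset.mem_singleton.1 p.2
    have hq := Finset.mem_singleton.1 q.2
    change dist (p : X) q ≤ 0
    rw [hp, hq, dist_self]

/-- A connected graph on `M` has at least `#M - 1` edges, none of them shorter than `s`. -/
lemma mul_le_mst {M : Finset X} (hM : M.Nonempty) {s : ℝ} (hs : 0 ≤ s)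
    (h : ∀ p ∈ M, ∀ q ∈ M, p ≠ q → s ≤ dist p q) : ((M.card : ℝ) - 1) * s ≤ mst M := by
  classical
  have := nonempty_connected hM
  refine le_ciInf fun ⟨G, hG⟩ => ?_
  have hcard : (M.card : ℝ) ≤ G.edgeFinset.card + 1 := by
    have := hG.card_vert_le_card_edgeSet_add_one
    rw [Nat.card_eq_fintype_card, Nat.card_eq_fintype_card, Fintype.card_coe,
      ← SimpleGraph.edgeFinset_card] at this
    exact_mod_cast this
  have hsum : G.edgeFinset.card • s ≤ ∑ e ∈ G.edgeFinset, edgeLength e := by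
    refine Finset.card_nsmul_le_sum _ _ _ fun e he => ?_
    induction e using Sym2.ind with
    | _ p q =>
      rw [SimpleGraph.mem_edgeFinset, SimpleGraph.mem_edgeSet] at he
      exact h p p.2 q q.2 fun hpq => he.ne (Subtype.ext hpq)
  calc ((M.card : ℝ) - 1) * s ≤ G.edgeFinset.card • s := by
        rw [nsmul_eq_mul]
        exact mul_le_mul_of_nonneg_right (by linarith) hs
    _ ≤ graphLength G := by
        rwa [graphLength_eq_sum]

/-- A new point can be attached to a spanning tree by an edge to any of the old points. -/
lemma mst_insert_le [DecidableEq X] {N : Finset X} {y : X} (hy : y ∈ N) (x : X) :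
    mst (insert x N) ≤ mst N + dist x y := by
  classical
  have := nonempty_connected ⟨y, hy⟩
  by_cases hx : x ∈ N
  · rw [Finset.insert_eq_of_mem hx]
    linarith [dist_nonneg (x := x) (y := y)]
  rw [← sub_le_iff_le_add]
  refine le_ciInf fun ⟨G, hG⟩ => ?_
  rw [sub_le_iff_le_add]
  let f : N ↪ (insert x N : Finset X) :=
    ⟨fun p => ⟨p, Finset.mem_insert_of_mem p.2⟩, fun p q h => by simpa using h⟩
  let x' : (insert x N : Finset X) := ⟨x, Finset.mem_insert_self x N⟩
  let y' : (insert x N : Finset X) := f ⟨y, hy⟩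
  have hxy : x' ≠ y' := fun h => hx (by
    have : x = y := congrArg Subtype.val h
    exact this ▸ hy)
  let H := G.map f ⊔ SimpleGraph.edge x' y'
  have hreach : ∀ p, H.Reachable p y' := by
    rintro ⟨p, hp⟩
    rcases Finset.mem_insert.1 hp with rfl | hp'
    · refine SimpleGraph.Adj.reachable (Or.inr ?_)
      rw [SimpleGraph.edge_adj]
      exact ⟨Or.inl ⟨rfl, rfl⟩, hxy⟩
    · have h1 : (G.map f).Reachable (f ⟨p, hp'⟩) (f ⟨y, hy⟩) :=
        (hG.preconnected ⟨p, hp'⟩ ⟨y, hy⟩).map (SimpleGraph.Embedding.map f G).toHom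
      exact h1.mono le_sup_left
  have hH : H.Connected :=
    { preconnected := fun p q => (hreach p).trans (hreach q).symm, nonempty := ⟨x'⟩ }
  refine (mst_le_graphLength hH).trans ?_
  have hsub : H.edgeFinset ⊆ G.edgeFinset.map f.sym2Map ∪ {s(x', y')} := by
    intro e
    induction e using Sym2.ind with
    | _ p q =>
      rw [SimpleGraph.mem_edgeFinset, SimpleGraph.mem_edgeSet, Finset.mem_union,
        Finset.mem_singleton, Finset.mem_map]
      rintro (h | h)
      · obtain ⟨-, a, b, hab, rfl, rfl⟩ := h
        exact Or.inl ⟨s(a, b), by simpa using hab, rfl⟩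
      · rw [SimpleGraph.edge_adj] at h
        exact Or.inr (Sym2.eq_iff.2 (by tauto))
  have hmap : ∀ e : Sym2 N, edgeLength (f.sym2Map e) = edgeLength e := by
    intro e
    induction e using Sym2.ind with
    | _ p q => rfl
  calc graphLength H
      ≤ ∑ e ∈ G.edgeFinset.map f.sym2Map ∪ {s(x', y')}, edgeLength e := by
        rw [graphLength_eq_sum]
        exact Finset.sum_le_sum_of_subset_of_nonneg hsub fun e _ _ => edgeLength_nonneg e
    _ ≤ ∑ e ∈ G.edgeFinset.map f.sym2Map, edgeLength e + edgeLength s(x', y') := by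
        rw [← Finset.sum_singleton edgeLength s(x', y'), ← Finset.sum_union_inter]
        exact le_add_of_nonneg_right (Finset.sum_nonneg fun e _ => edgeLength_nonneg e)
    _ = graphLength G + dist x y := by
        rw [Finset.sum_map, graphLength_eq_sum]
        simp only [hmap]
        rfl

/-- Every `p i` is attached to a point `q i` of `N`. -/
lemma mst_union_image_le [DecidableEq X] {ι : Type*} (N : Finset X) (s : Finset ι) (p q : ι → X)
    (hq : ∀ i, q i ∈ N) :
    mst (s.image p ∪ N) ≤ mst N + ∑ i ∈ s, dist (p i) (q i) := by
  classical
  induction s using Finset.induction_on with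
  | empty => simp
  | insert i s hi ih =>
    rw [Finset.image_insert, Finset.insert_union, Finset.sum_insert hi]
    linarith [mst_insert_le (Finset.mem_union_right (s.image p) (hq i)) (p i)]

end MetricSpace

/-! ### Shortening a fork -/

/-- Two segments of length `r` from the origin to `u` and `v`, at an angle with cosine at least
`-1 / 3`, are together longer than the fork with the same endpoints that branches at
`(u + v) / 8`. -/
lemma norm_add_norm_sub_add_norm_sub_lt {E : Type*} [NormedAddCommGroup E] [InnerProductSpace ℝ E]
    {u v : E} {r : ℝ} (hr : 0 < r) (hu : ‖u‖ = r) (hv : ‖v‖ = r)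
    (huv : -(r ^ 2 / 3) ≤ inner ℝ u v) :
    ‖(1 / 8 : ℝ) • (u + v)‖ + ‖u - (1 / 8 : ℝ) • (u + v)‖ + ‖v - (1 / 8 : ℝ) • (u + v)‖
      < 2 * r := by
  have hB := norm_add_sq_real u v
  rw [hu, hv] at hB
  have key : ∀ w : E, ‖w‖ = r → inner ℝ w (u + v) = r ^ 2 + inner ℝ u v →
      ‖w - (1 / 8 : ℝ) • (u + v)‖ < r - ‖u + v‖ / 16 := by
    intro w hw hin
    have hle : ‖u + v‖ ≤ 2 * r := by linarith [norm_add_le u v]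
    -- the squares differ by `‖u + v‖ * (29 * ‖u + v‖ - 32 * r) / 256`, and `(32 / 29)² < 4 / 3`
    have hgt : 32 * r < 29 * ‖u + v‖ := by
      refine lt_of_pow_lt_pow_left₀ 2 (by positivity) ?_
      nlinarith [pow_pos hr 2]
    refine lt_of_pow_lt_pow_left₀ 2 (by linarith) ?_
    rw [norm_sub_sq_real, real_inner_smul_right, hin, norm_smul, hw]
    norm_num
    nlinarith
  have h1 := key u hu (by rw [inner_add_right, real_inner_self_eq_norm_sq, hu])
  have h2 := key v hv (by
    rw [inner_add_right, real_inner_self_eq_norm_sq, hv, real_inner_comm]; ring)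
  have h3 : ‖(1 / 8 : ℝ) • (u + v)‖ = ‖u + v‖ / 8 := by
    rw [norm_smul]; norm_num; ring
  linarith

/-! ### The regular simplex -/

section Simplex

variable {n : ℕ}

/-- The point of `ℝⁿ` all of whose coordinates are `k`. -/
def diagonalPoint (n : ℕ) (k : ℝ) : EuclideanSpace ℝ (Fin n) :=
  WithLp.toLp 2 fun _ => k

/-- The vertices of a regular simplex in `ℝⁿ` with edge length `√2`: the `n` standard basis
vectors and a point of the diagonal, whose coordinate `k` is a root of `n k² - 2 k - 1`. -/
noncomputable def simplexVertex (n : ℕ) : Option (Fin n) → EuclideanSpace ℝ (Fin n)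
  | none => diagonalPoint n ((1 - √(n + 1)) / n)
  | some i => EuclideanSpace.single i 1

/-- The centre of the simplex `simplexVertex n`. -/
noncomputable def simplexCenter (n : ℕ) : EuclideanSpace ℝ (Fin n) :=
  diagonalPoint n ((1 + (1 - √(n + 1)) / n) / (n + 1))

lemma norm_diagonalPoint_sq (k : ℝ) : ‖diagonalPoint n k‖ ^ 2 = n * k ^ 2 := by
  simp [diagonalPoint, EuclideanSpace.norm_sq_eq]

lemma diagonalPoint_sub (k l : ℝ) :
    diagonalPoint n k - diagonalPoint n l = diagonalPoint n (k - l) := by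
  ext; simp [diagonalPoint]

lemma dist_single_diagonalPoint_sq (i : Fin n) (k : ℝ) :
    dist (EuclideanSpace.single i (1 : ℝ)) (diagonalPoint n k) ^ 2 = 1 - 2 * k + n * k ^ 2 := by
  rw [dist_eq_norm, norm_sub_sq_real, norm_diagonalPoint_sq, EuclideanSpace.inner_single_left]
  simp [diagonalPoint]

lemma dist_simplexVertex (hn : n ≠ 0) {a b : Option (Fin n)} (hab : a ≠ b) :
    dist (simplexVertex n a) (simplexVertex n b) = √2 := by
  have hn' : (n : ℝ) ≠ 0 := by exact_mod_cast hn
  have hS : √((n : ℝ) + 1) ^ 2 = n + 1 := Real.sq_sqrt (by positivity)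
  have h : ∀ i, dist (simplexVertex n (some i)) (simplexVertex n none) = √2 := by
    intro i
    rw [← Real.sqrt_sq dist_nonneg, simplexVertex, simplexVertex, dist_single_diagonalPoint_sq]
    congr 1
    field_simp
    linear_combination hS
  match a, b with
  | none, none => exact absurd rfl hab
  | some i, none => exact h i
  | none, some i => rw [dist_comm]; exact h i
  | some i, some j =>
    have hij : i ≠ j := fun h => hab (congrArg some h)
    rw [← Real.sqrt_sq dist_nonneg, simplexVertex, simplexVertex, dist_eq_norm, norm_sub_sq_real,
      EuclideanSpace.inner_single_left]
    simp [hij]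
    norm_num

lemma dist_simplexVertex_simplexCenter (hn : n ≠ 0) (a : Option (Fin n)) :
    dist (simplexVertex n a) (simplexCenter n) = √(n / (n + 1)) := by
  have hn' : (n : ℝ) ≠ 0 := by exact_mod_cast hn
  have hn1 : (n : ℝ) + 1 ≠ 0 := by positivity
  have hS : √((n : ℝ) + 1) ^ 2 = n + 1 := Real.sq_sqrt (by positivity)
  rw [← Real.sqrt_sq dist_nonneg]
  congr 1
  match a with
  | none =>
    rw [simplexVertex, simplexCenter, dist_eq_norm, diagonalPoint_sub, norm_diagonalPoint_sq]
    field_simp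
    linear_combination ((n : ℝ) ^ 2) * hS
  | some i =>
    rw [simplexVertex, simplexCenter, dist_single_diagonalPoint_sq]
    field_simp
    linear_combination hS

/-- The vertices of the simplex are connected by a tree shorter than the star at its centre: the
vertices `0` and `1` are joined to a branching point near the centre, the others to the centre. -/
lemma smt_simplex_lt (hn : 3 ≤ n) :
    smt (Finset.univ.image (simplexVertex n)) < (n + 1) * √(n / (n + 1)) := by
  have hn0 : n ≠ 0 := by omega
  have hn3 : (3 : ℝ) ≤ n := by exact_mod_cast hn
  set r : ℝ := √(n / (n + 1)) with hr
  have hrpos : 0 < r := Real.sqrt_pos.2 (by positivity)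
  have hrsq : r ^ 2 = n / (n + 1) := Real.sq_sqrt (by positivity)
  set O := simplexCenter n
  have hO : ∀ a, dist (simplexVertex n a) O = r := dist_simplexVertex_simplexCenter hn0
  let a : Option (Fin n) := some ⟨0, by omega⟩
  let b : Option (Fin n) := some ⟨1, by omega⟩
  have hab : a ≠ b := by simp [a, b]
  set u := simplexVertex n a - O with hu
  set v := simplexVertex n b - O with hv
  have hun : ‖u‖ = r := by rw [hu, ← dist_eq_norm, hO]
  have hvn : ‖v‖ = r := by rw [hv, ← dist_eq_norm, hO]
  have huv : -(r ^ 2 / 3) ≤ inner ℝ u v := by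
    have h1 := norm_sub_sq_real u v
    have h2 : ‖u - v‖ ^ 2 = 2 := by
      rw [hu, hv, sub_sub_sub_cancel_right, ← dist_eq_norm, dist_simplexVertex hn0 hab]
      norm_num
    rw [h2, hun, hvn] at h1
    have h3 : 3 / 4 ≤ r ^ 2 := by
      rw [hrsq, le_div_iff₀ (by positivity)]; linarith
    linarith
  have hfork := norm_add_norm_sub_add_norm_sub_lt hrpos hun hvn huv
  set S := O + (1 / 8 : ℝ) • (u + v) with hS
  have hSO : dist S O = ‖(1 / 8 : ℝ) • (u + v)‖ := by rw [dist_eq_norm, hS, add_sub_cancel_left]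
  have hSa : dist (simplexVertex n a) S = ‖u - (1 / 8 : ℝ) • (u + v)‖ := by
    rw [dist_eq_norm, hS, ← sub_sub]
  have hSb : dist (simplexVertex n b) S = ‖v - (1 / 8 : ℝ) • (u + v)‖ := by
    rw [dist_eq_norm, hS, ← sub_sub]
  rw [← hSO, ← hSa, ← hSb] at hfork
  let q : Option (Fin n) → EuclideanSpace ℝ (Fin n) := fun i => if i = a ∨ i = b then S else O
  have hq : ∀ i, q i ∈ ({S, O} : Finset (EuclideanSpace ℝ (Fin n))) := by
    intro i
    by_cases h : i = a ∨ i = b <;> simp [q, h]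
  have hbase : mst ({S, O} : Finset (EuclideanSpace ℝ (Fin n))) ≤ dist S O := by
    have := mst_insert_le (Finset.mem_singleton_self O) S
    rwa [mst_singleton, zero_add] at this
  have hsum : ∑ i, dist (simplexVertex n i) (q i) =
      dist (simplexVertex n a) S + dist (simplexVertex n b) S + (n - 1) * r := by
    have hbm : b ∈ Finset.univ.erase a := Finset.mem_erase.2 ⟨hab.symm, Finset.mem_univ b⟩
    rw [← Finset.add_sum_erase _ _ (Finset.mem_univ a), ← Finset.add_sum_erase _ _ hbm,
      Finset.sum_congr rfl (g := fun _ => r), Finset.sum_const,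
      Finset.card_erase_of_mem hbm, Finset.card_erase_of_mem (Finset.mem_univ a), Finset.card_univ,
      Fintype.card_option, Fintype.card_fin, nsmul_eq_mul, Nat.add_sub_cancel,
      Nat.cast_sub (by omega)]
    · simp [q, add_assoc]
    · intro i hi
      simp only [Finset.mem_erase] at hi
      simp [q, hi.1, hi.2.1, hO]
  have hle := (smt_le_mst Finset.subset_union_left).trans
    (mst_union_image_le {S, O} Finset.univ (simplexVertex n) q hq)
  rw [hsum] at hle
  linarith

end Simplex

end SteinerTree

theorem mainTheorem6 (n : ℕ) (hn : 3 ≤ n) :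
    SteinerTree.steinerRatio (EuclideanSpace ℝ (Fin n)) <
      Real.sqrt (1 / 2 + 1 / (2 * (n : ℝ))) := by
  have hn0 : n ≠ 0 := by omega
  have hnpos : (0 : ℝ) < n := by positivity
  set M := Finset.univ.image (SteinerTree.simplexVertex n) with hM
  have hinj : Function.Injective (SteinerTree.simplexVertex n) := by
    intro a b h
    by_contra hab
    have := SteinerTree.dist_simplexVertex hn0 hab
    rw [h, dist_self] at this
    exact (Real.sqrt_pos.2 two_pos).ne this
  have hcard : M.card = n + 1 := by
    rw [hM, Finset.card_image_of_injective _ hinj, Finset.card_univ, Fintype.card_option,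
      Fintype.card_fin]
  have hmst : n * √2 ≤ SteinerTree.mst M := by
    have := SteinerTree.mul_le_mst (M := M) (s := √2) (Finset.card_pos.1 (by omega))
      (by positivity) (by
        intro p hp q hq hpq
        obtain ⟨a, -, rfl⟩ := Finset.mem_image.1 hp
        obtain ⟨b, -, rfl⟩ := Finset.mem_image.1 hq
        exact (SteinerTree.dist_simplexVertex hn0 fun h => hpq (congrArg _ h)).ge)
    rwa [hcard, Nat.cast_add_one, add_sub_cancel_right] at this
  have hpos : 0 < n * √2 := by positivity
  refine (SteinerTree.steinerRatio_le (M := M) (by omega)).trans_lt ?_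
  rw [div_lt_iff₀ (hpos.trans_le hmst)]
  calc SteinerTree.smt M < (n + 1) * √(n / (n + 1)) := SteinerTree.smt_simplex_lt hn
    _ = √(1 / 2 + 1 / (2 * n)) * (n * √2) := by
        rw [← sq_eq_sq₀ (by positivity) (by positivity)]
        simp only [mul_pow]
        rw [Real.sq_sqrt (by positivity), Real.sq_sqrt (by positivity),
          Real.sq_sqrt (by positivity)]
        field_simp
    _ ≤ √(1 / 2 + 1 / (2 * n)) * SteinerTree.mst M := by gcongr
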